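/- Let $\mathbb K$ be $\mathbb R$ or $\mathbb C$. Let $X$ be an infinite-dimensional Fréchet space over $\mathbb K$ on which there exists a continuous norm, let $Y$ be a separable Fréchet space over $\mathbb K$, and let $(T_n)_{n\ge 1}$ be a sequence of continuous linear operators from $X$ to $Y$. Let $(n_k)$ be a (strictly) increasing sequence of positive integers. Suppose that $(T_n)$ satisfies condition (C) for $(n_k)$, that is: 1. there is a dense subset $X_0\subset X$ such that $T_{n_k}x\to 0$ as $k\to\infty$ for every $x\in X_0$; and 2. for every continuous seminorm $p$ on $X$, the set $\bigcup_k T_{n_k}(\{x\in X: p(x)<1\})$ is dense in $Y$. Suppose moreover that there is an infinite-dimensional closed linear subspace $M_0$ of $X$ such that $T_{n_k}x\to 0$ as $k\to\infty$ for every $x\in M_0$. Then $(T_n)$ has a hypercyclic subspace: there is an infinite-dimensional closed linear subspace $M$ of $X$ such that for every non-zero $x\in M$ the set $\{T_nx : n\ge 1\}$ is dense in $Y$. -/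

import Mathlib

open Filter Topology

/-- A Fréchet space over `𝕜` (real or complex): a complete Hausdorff space whose topology is
defined by a countable family of seminorms. (The uniformity is the one determined by the additive
group and its topology.) -/
structure IsFrechetSpace (𝕜 X : Type*) [RCLike 𝕜] [AddCommGroup X] [Module 𝕜 X]
    [UniformSpace X] [IsUniformAddGroup X] : Prop where
  exists_seminorms : ∃ p : ℕ → Seminorm 𝕜 X, WithSeminorms p
  t2 : T2Space X
  complete : CompleteSpace X

/-- `X` admits a norm that is continuous for the topology of `X`. -/
def HasContinuousNorm (𝕜 X : Type*) [RCLike 𝕜] [AddCommGroup X] [Module 𝕜 X]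
    [TopologicalSpace X] : Prop :=
  ∃ p : Seminorm 𝕜 X, Continuous p ∧ ∀ x : X, p x = 0 → x = 0

section

variable {𝕜 X Y : Type*} [RCLike 𝕜]
  [AddCommGroup X] [Module 𝕜 X] [TopologicalSpace X]
  [AddCommGroup Y] [Module 𝕜 Y] [TopologicalSpace Y]

/-- The sequence `(T_n)_{n ≥ 1}` satisfies condition (C) for the increasing sequence `(n_k)` of
positive integers. -/
structure SatisfiesConditionC (T : ℕ+ → X →L[𝕜] Y) (n : ℕ → ℕ+) : Prop where
  strictMono : StrictMono n
  exists_dense : ∃ X₀ : Set X, Dense X₀ ∧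
    ∀ x ∈ X₀, Tendsto (fun k => T (n k) x) atTop (𝓝 0)
  dense_iUnion : ∀ p : Seminorm 𝕜 X, Continuous p →
    Dense (⋃ k : ℕ, T (n k) '' {x : X | p x < 1})

/-- The vector `x` is hypercyclic for `(T_n)_{n ≥ 1}`. -/
def IsHypercyclicVector (T : ℕ+ → X →L[𝕜] Y) (x : X) : Prop :=
  Dense (Set.range fun n : ℕ+ => T n x)

/-- `M` is an infinite-dimensional closed subspace in which every non-zero vector is hypercyclic
for `(T_n)_{n ≥ 1}`. -/
structure IsHypercyclicSubspace (T : ℕ+ → X →L[𝕜] Y) (M : Submodule 𝕜 X) : Prop where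
  infinite_dimensional : ¬ FiniteDimensional 𝕜 M
  isClosed : IsClosed (M : Set X)
  hypercyclic : ∀ x ∈ M, x ≠ 0 → IsHypercyclicVector T x

end

/-! The subspace is a small perturbation `L = id + K` of a separable closed infinite-dimensional `M₁
≤ M₀`, with `K x = ∑ f_{j i}(x) u_i`. The functionals `f_j` are bounded by the continuous norm `p`
and separate `M₁` from 0. The vectors `u_i` are tiny and almost biorthogonal to the operators `T_{n
(k m)}`, which send `u_m` near `y_m` and the other `u_i` near 0 (`exists_almost_biorthogonal_seq`).
For `z ∈ M₁`, `T_{n (k m)} z → 0`, so `T_{n (k m)} (L z)` is asymptotic to `f_{j m}(z) y_m`. Each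
pair (functional, point of a dense sequence) recurs infinitely often as `(f_{j m}, y_m)`, so the
closure of the orbit contains a non-zero multiple of the dense sequence. Since `p (K x) ≤ p x / 2`,
`L` is injective; as `p` also controls `K` in every seminorm, `L` maps closed sets to closed sets
(`isClosed_image_id_add`). -/

/-! ### Recursion and seminorm tools. -/

theorem exists_seq_of_forall_finite_history {α : Type*} [Nonempty α]
    (R : ℕ → α → Prop) (S : ℕ → α → α → Prop)
    (h : ∀ (m : ℕ) (g : ℕ → α), (∀ i < m, R i (g i)) → ∃ a, R m a ∧ ∀ i < m, S m (g i) a) :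
    ∃ f : ℕ → α, (∀ m, R m (f m)) ∧ ∀ m, ∀ i < m, S m (f i) (f m) := by
  classical
  -- `epsilon` makes the recursion total; strong induction later shows that the history is always
  -- admissible.
  let F : ∀ m : ℕ, (∀ i, i < m → α) → α := fun m ih =>
    Classical.epsilon fun a => R m a ∧ ∀ (i : ℕ) (hi : i < m), S m (ih i hi) a
  let f : ℕ → α := fun m => Nat.strongRec F m
  have hf : ∀ m, f m = F m fun i _ => f i := fun m => Nat.strongRec_eq F m
  have key : ∀ m, R m (f m) ∧ ∀ i < m, S m (f i) (f m) := by
    intro m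
    induction m using Nat.strong_induction_on with
    | _ m ih =>
      have := Classical.epsilon_spec (h m f fun i hi => (ih i hi).1)
      rw [hf m]
      exact this
  exact ⟨f, fun m => (key m).1, fun m => (key m).2⟩

/-- Hahn–Banach in the normed space `(E, p)`; no other topology on `E` is involved. -/
theorem Seminorm.exists_dual_vector_of_separating {𝕜 E : Type*} [RCLike 𝕜] [AddCommGroup E]
    [Module 𝕜 E] (p : Seminorm 𝕜 E) (hp : ∀ x, p x = 0 → x = 0) (x : E) :
    ∃ f : E →ₗ[𝕜] 𝕜, (∀ y, ‖f y‖ ≤ p y) ∧ ‖f x‖ = p x := by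
  let _ : NormedAddCommGroup E :=
    AddGroupNorm.toNormedAddCommGroup
      { p.toAddGroupSeminorm with eq_zero_of_map_eq_zero' := hp }
  let _ : NormedSpace 𝕜 E := { norm_smul_le := fun a b => (map_smul_eq_mul p a b).le }
  obtain ⟨g, hg, hgx⟩ := exists_dual_vector'' 𝕜 x
  refine ⟨g.toLinearMap, fun y => ?_, ?_⟩
  · exact (g.le_of_opNorm_le hg y).trans (one_mul _).le
  · change ‖g x‖ = ‖x‖
    rw [hgx]; simp

theorem WithSeminorms.summable_of_summable_seminorm {𝕜 E ι β : Type*} [NormedField 𝕜]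
    [AddCommGroup E] [Module 𝕜 E] [UniformSpace E] [IsUniformAddGroup E] [CompleteSpace E]
    {q : ι → Seminorm 𝕜 E} (hq : WithSeminorms q) {g : β → E}
    (h : ∀ s, Summable fun i => q s (g i)) : Summable g := by
  classical
  rw [summable_iff_vanishing]
  intro e he
  obtain ⟨I, r, hr, hI⟩ := (hq.mem_nhds_iff 0 e).1 he
  have hsum : Summable fun i => (I.sup q) (g i) := by
    refine Summable.of_nonneg_of_le (fun _ => apply_nonneg _ _) (fun i => ?_)
      (summable_sum (s := I) fun s _ => h s)
    have := Seminorm.finset_sup_le_sum q I (g i)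
    simpa using this
  obtain ⟨s, hs⟩ := hsum.vanishing (Metric.ball_mem_nhds (0 : ℝ) hr)
  refine ⟨s, fun t ht => hI ?_⟩
  rw [Seminorm.mem_ball_zero]
  refine lt_of_le_of_lt ?_ (lt_of_abs_lt (by simpa using hs t ht))
  have hle : ∀ P : Seminorm 𝕜 E, P (∑ i ∈ t, g i) ≤ ∑ i ∈ t, P (g i) := fun P =>
    Finset.le_sum_of_subadditive P (map_zero P).le (map_add_le_add P) t g
  exact hle _

theorem Seminorm.le_of_hasSum {𝕜 E β : Type*} [NormedField 𝕜] [AddCommGroup E] [Module 𝕜 E]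
    [TopologicalSpace E] {q : Seminorm 𝕜 E} (hq : Continuous q) {g : β → E} {z : E}
    (hg : HasSum g z) {c : β → ℝ} {C : ℝ} (hc : HasSum c C) (h : ∀ i, q (g i) ≤ c i) :
    q z ≤ C := by
  refine le_of_tendsto_of_tendsto' ((hq.tendsto z).comp hg) hc fun t => ?_
  exact (Finset.le_sum_of_subadditive q (map_zero _).le (map_add_le_add q) t g).trans
    (Finset.sum_le_sum fun i _ => h i)

/-! ### Almost biorthogonal vectors. -/

section

variable {𝕜 X Y : Type*} [RCLike 𝕜]
  [AddCommGroup X] [Module 𝕜 X] [UniformSpace X] [IsUniformAddGroup X]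
  [AddCommGroup Y] [Module 𝕜 Y] [UniformSpace Y] [IsUniformAddGroup Y]

/-- Transitivity along arbitrarily late indices, with vectors close to the origin chosen in a
prescribed dense set. -/
theorem exists_small_mem_dense_of_dense_iUnion [T2Space Y] [ContinuousSMul 𝕜 Y]
    {q : ℕ → Seminorm 𝕜 X} (hq : WithSeminorms q) (S : ℕ → X →L[𝕜] Y)
    (hS : ∀ p : Seminorm 𝕜 X, Continuous p → Dense (⋃ k : ℕ, S k '' {x : X | p x < 1}))
    {X₀ : Set X} (hX₀ : Dense X₀) {U : Set X} (hU : U ∈ 𝓝 0) {V : Set Y} (hV : IsOpen V)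
    (hVne : V.Nonempty) (K : ℕ) :
    ∃ x ∈ X₀, ∃ k ≥ K, x ∈ U ∧ S k x ∈ V := by
  have hS' : ∀ U ∈ 𝓝 (0 : X), Dense (⋃ k : ℕ, S k '' U) := by
    intro U hU
    obtain ⟨I, r, hr, hI⟩ := (hq.mem_nhds_iff 0 U).1 hU
    let P₀ : Seminorm 𝕜 X := I.sup q
    have hc : Continuous P₀ := by
      have := hq.continuousSMul
      refine Seminorm.continuous (r := 1) ?_
      exact hq.hasBasis_zero_ball.mem_of_mem (i := (I, 1)) one_pos
    let P : Seminorm 𝕜 X := Real.toNNReal r⁻¹ • P₀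
    have hPv : ∀ x, P x = r⁻¹ * P₀ x := fun x => by
      change ((Real.toNNReal r⁻¹ : NNReal) : ℝ) * P₀ x = _
      rw [Real.coe_toNNReal _ (by positivity)]
    have hP : Continuous P := (hc.const_mul r⁻¹).congr fun x => (hPv x).symm
    refine (hS P hP).mono (Set.iUnion_mono fun k => Set.image_mono fun x hx => hI ?_)
    rw [Seminorm.mem_ball_zero]
    have hx' : r⁻¹ * P₀ x < 1 := hPv x ▸ hx
    rwa [inv_mul_lt_iff₀ hr, mul_one] at hx'
  suffices h : ∃ k ≥ K, ∃ x ∈ interior U, S k x ∈ V by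
    obtain ⟨k, hk, x, hxU, hxV⟩ := h
    obtain ⟨z, hz, hz₀⟩ := hX₀.inter_open_nonempty (interior U ∩ S k ⁻¹' V)
      (isOpen_interior.inter (hV.preimage (S k).continuous)) ⟨x, hxU, hxV⟩
    exact ⟨z, hz₀, k, hk, interior_subset hz.1, hz.2⟩
  rcases subsingleton_or_nontrivial Y with hY | hY
  · obtain ⟨v, hv⟩ := hVne
    exact ⟨K, le_rfl, 0, mem_interior_iff_mem_nhds.2 hU, Subsingleton.elim v (S K 0) ▸ hv⟩
  have := Module.punctured_nhds_neBot 𝕜 Y 0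
  obtain ⟨y, hyV, hy0⟩ := (dense_compl_singleton (0 : Y)).inter_open_nonempty V hV hVne
  -- Near 0 the finitely many `S k` with `k < K` take values in `B`, so reaching `A` forces `k ≥ K`.
  obtain ⟨A, B, hA, hB, hyA, h0B, hAB⟩ := t2_separation (show y ≠ 0 from hy0)
  have hW : interior U ∩ {x | ∀ k ∈ Finset.range K, S k x ∈ B} ∈ 𝓝 (0 : X) := by
    refine inter_mem (isOpen_interior.mem_nhds (mem_interior_iff_mem_nhds.2 hU)) ?_
    refine (Filter.eventually_all_finset _).2 fun k _ => ?_
    exact (S k).continuous.tendsto' 0 0 (map_zero _) (hB.mem_nhds h0B)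
  obtain ⟨z, ⟨hzV, hzA⟩, hz⟩ := (hS' _ hW).inter_open_nonempty _ (hV.inter hA) ⟨y, hyV, hyA⟩
  obtain ⟨k, x, hx, rfl⟩ := Set.mem_iUnion.1 hz
  refine ⟨k, ?_, x, hx.1, hzV⟩
  by_contra hk
  exact Set.disjoint_left.1 hAB hzA (hx.2 k (Finset.mem_range.2 (not_le.1 hk)))

/-- Given the earlier pairs, `u m` is taken so small that the chosen operators `S (k i)` barely move
it, and `k m` so late that `S (k m)` nearly kills each earlier `u i`, which lies in `X₀`. -/
theorem exists_almost_biorthogonal_seq [T2Space Y]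
    {q : ℕ → Seminorm 𝕜 X} (hq : WithSeminorms q) {r : ℕ → Seminorm 𝕜 Y} (hr : WithSeminorms r)
    {p : Seminorm 𝕜 X} (hp : Continuous p) (S : ℕ → X →L[𝕜] Y)
    (hS : ∀ p : Seminorm 𝕜 X, Continuous p → Dense (⋃ k : ℕ, S k '' {x : X | p x < 1}))
    {X₀ : Set X} (hX₀ : Dense X₀) (hS₀ : ∀ x ∈ X₀, Tendsto (fun k => S k x) atTop (𝓝 0))
    (y : ℕ → Y) :
    ∃ (u : ℕ → X) (k : ℕ → ℕ), (∀ m, m ≤ k m) ∧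
      (∀ m, p (u m) ≤ (1 / 4) ^ (m + 1)) ∧
      (∀ m, ∀ s ≤ m, q s (u m) ≤ (1 / 4) ^ (m + 1)) ∧
      ∀ m, ∀ s ≤ m, ∀ i,
        r s (S (k m) (u i) - if i = m then y m else 0) ≤ (1 / 2) ^ m * (1 / 2) ^ i := by
  have := hr.continuousSMul
  obtain ⟨f, hfR, hfS⟩ := exists_seq_of_forall_finite_history (α := X × ℕ)
    (fun m a => a.1 ∈ X₀ ∧ m ≤ a.2 ∧ p a.1 < (1 / 4) ^ (m + 1) ∧ (∀ s ≤ m, q s a.1 < (1 / 4) ^ (m + 1)) ∧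
      ∀ s ≤ m, r s (S a.2 a.1 - y m) < (1 / 4) ^ (m + 1))
    (fun m b a => ∀ s ≤ m, r s (S b.2 a.1) < (1 / 4) ^ (m + 1) ∧
      r s (S a.2 b.1) < (1 / 4) ^ (m + 1)) (by
    intro m g hg
    have hε : (0 : ℝ) < (1 / 4) ^ (m + 1) := by positivity
    generalize ((1 / 4 : ℝ) ^ (m + 1)) = ε at hε
    have hlt : ∀ {E : Type _} [AddCommGroup E] [Module 𝕜 E] [TopologicalSpace E]
        (φ : E → ℝ), Continuous φ → φ 0 = 0 → ∀ᶠ x in 𝓝 (0 : E), φ x < ε := by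
      intro E _ _ _ φ hφ h0
      exact hφ.continuousAt.eventually_lt continuousAt_const (by simpa [h0] using hε)
    have hU : ∀ᶠ x in 𝓝 (0 : X), p x < ε ∧ (∀ s ∈ Set.Iic m, q s x < ε) ∧
        ∀ i ∈ Set.Iio m, ∀ s ∈ Set.Iic m, r s (S (g i).2 x) < ε := by
      refine (hlt p hp (map_zero p)).and (Filter.Eventually.and ?_ ?_)
      · exact (Filter.eventually_all_finite (Set.finite_Iic m)).2 fun s _ =>
          hlt (q s) (hq.continuous_seminorm s) (map_zero _)
      · refine (Filter.eventually_all_finite (Set.finite_Iio m)).2 fun i _ =>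
          (Filter.eventually_all_finite (Set.finite_Iic m)).2 fun s _ => ?_
        exact hlt (fun x => r s (S (g i).2 x))
          ((hr.continuous_seminorm s).comp (S (g i).2).continuous) (by simp)
    have hK : ∀ᶠ k in atTop, ∀ i ∈ Set.Iio m, ∀ s ∈ Set.Iic m, r s (S k (g i).1) < ε := by
      refine (Filter.eventually_all_finite (Set.finite_Iio m)).2 fun i hi =>
        (Filter.eventually_all_finite (Set.finite_Iic m)).2 fun s _ => ?_
      have := (hr.tendsto_nhds _ _).1 (hS₀ _ (hg i hi).1) s ε hε
      simpa using this
    obtain ⟨K, hK⟩ := eventually_atTop.1 hK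
    let V : Set Y := ⋂ s ∈ Set.Iic m, {z | r s (z - y m) < ε}
    have hV : IsOpen V := (Set.finite_Iic m).isOpen_biInter fun s _ =>
      isOpen_lt ((hr.continuous_seminorm s).comp (continuous_id.sub continuous_const))
        continuous_const
    have hyV : y m ∈ V := by simp [V, hε]
    obtain ⟨x, hx₀, k, hkK, ⟨hxp, hxq, hxr⟩, hxV⟩ :=
      exists_small_mem_dense_of_dense_iUnion hq S hS hX₀ hU hV ⟨_, hyV⟩ (max K m)
    refine ⟨(x, k), ⟨hx₀, (le_max_right _ _).trans hkK, hxp, hxq, fun s hs => ?_⟩, fun i hi s hs =>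
      ⟨hxr i hi s hs, hK k ((le_max_left _ _).trans hkK) i hi s hs⟩⟩
    exact Set.mem_iInter₂.1 hxV s hs)
  refine ⟨fun m => (f m).1, fun m => (f m).2, fun m => (hfR m).2.1,
    fun m => (hfR m).2.2.1.le,
    fun m s hs => ((hfR m).2.2.2.1 s hs).le, fun m s hs i => ?_⟩
  -- The error is governed by the larger index; splitting it makes it summable in `i` and vanishing
  -- in `m`.
  have hpow : ∀ {a b : ℕ}, a ≤ b → (1 / 4 : ℝ) ^ (b + 1) ≤ (1 / 2) ^ a * (1 / 2) ^ b := by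
    intro a b hab
    calc (1 / 4 : ℝ) ^ (b + 1) ≤ (1 / 4) ^ b :=
          pow_le_pow_of_le_one (by norm_num) (by norm_num) (Nat.le_succ b)
      _ = (1 / 2) ^ b * (1 / 2) ^ b := by rw [← mul_pow]; norm_num
      _ ≤ (1 / 2) ^ a * (1 / 2) ^ b := by
          gcongr ?_ * _
          exact pow_le_pow_of_le_one (by norm_num) (by norm_num) hab
  rcases lt_trichotomy i m with h | rfl | h
  · rw [if_neg h.ne, sub_zero, mul_comm]
    exact ((hfS m i h s hs).2.le).trans (hpow h.le)
  · rw [if_pos rfl]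
    exact ((hfR i).2.2.2.2 s hs).le.trans (hpow le_rfl)
  · rw [if_neg h.ne', sub_zero]
    exact ((hfS i m h s (hs.trans h.le)).1.le).trans (hpow h.le)

/-! ### Separable subspaces, separating functionals and perturbations of the identity. -/

/-- An infinite-dimensional closed subspace contains an infinite-dimensional closed separable
subspace. -/
theorem exists_separable_closed_submodule [ContinuousSMul 𝕜 X] {M₀ : Submodule 𝕜 X}
    (hcl : IsClosed (M₀ : Set X)) (hdim : ¬ FiniteDimensional 𝕜 M₀) :
    ∃ M ≤ M₀, IsClosed (M : Set X) ∧ ¬ FiniteDimensional 𝕜 M ∧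
      TopologicalSpace.IsSeparable (M : Set X) := by
  let b := Module.Basis.ofVectorSpace 𝕜 M₀
  have hinf : Infinite (Module.Basis.ofVectorSpaceIndex 𝕜 M₀) := by
    by_contra h
    have : Finite (Module.Basis.ofVectorSpaceIndex 𝕜 M₀) := not_infinite_iff_finite.1 h
    exact hdim (Module.Finite.of_basis b)
  let φ := Infinite.natEmbedding (Module.Basis.ofVectorSpaceIndex 𝕜 M₀)
  let e : ℕ → X := fun i => b (φ i)
  have he : LinearIndependent 𝕜 e :=
    (b.linearIndependent.comp φ φ.injective).map' M₀.subtype (Submodule.ker_subtype M₀)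
  have hle : Submodule.span 𝕜 (Set.range e) ≤ M₀ :=
    Submodule.span_le.2 (Set.range_subset_iff.2 fun i => (b (φ i)).2)
  refine ⟨(Submodule.span 𝕜 (Set.range e)).topologicalClosure,
    Submodule.topologicalClosure_minimal _ hle hcl, Submodule.isClosed_topologicalClosure _,
    fun hfin => ?_, ?_⟩
  · have : FiniteDimensional 𝕜 (Submodule.span 𝕜 (Set.range e)) :=
      Submodule.finiteDimensional_of_le (Submodule.le_topologicalClosure _)
    have := (linearIndependent_span he).finite_of_isNoetherian
    exact not_finite ℕ
  · rw [Submodule.topologicalClosure_coe]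
    exact ((Set.countable_range e).isSeparable.span (R := 𝕜)).closure

/-- A countable family of functionals dominated by a norm that separates a separable set from
the origin. -/
theorem exists_separating_functionals {p : Seminorm 𝕜 X} (hp : Continuous p)
    (hp0 : ∀ x, p x = 0 → x = 0) {A : Set X} (hA : TopologicalSpace.IsSeparable A) :
    ∃ f : ℕ → X →ₗ[𝕜] 𝕜, (∀ j x, ‖f j x‖ ≤ p x) ∧ ∀ x ∈ A, x ≠ 0 → ∃ j, f j x ≠ 0 := by
  rcases A.eq_empty_or_nonempty with rfl | ⟨a, ha⟩
  · exact ⟨0, by simp, by simp⟩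
  obtain ⟨c, hc, hAc⟩ := hA
  obtain ⟨d, rfl⟩ := hc.exists_eq_range (closure_nonempty_iff.1 ⟨a, hAc ha⟩)
  choose f hf hfd using fun j => p.exists_dual_vector_of_separating hp0 (d j)
  refine ⟨f, hf, fun x hx hx0 => ?_⟩
  have hpx : 0 < p x := lt_of_le_of_ne (apply_nonneg p x) fun h => hx0 (hp0 x h.symm)
  have hO : IsOpen {z | p (x - z) < p x / 4} :=
    isOpen_lt (hp.comp (continuous_const.sub continuous_id)) continuous_const
  obtain ⟨_, hz, j, rfl⟩ := mem_closure_iff.1 (hAc hx) _ hO (by simpa using hpx)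
  refine ⟨j, fun h0 => ?_⟩
  -- `f j` norms `d j`, so if it killed the nearby `x` then `p (d j)`, and hence `p x`, would be too
  -- small.
  have h1 : p (d j) ≤ p (x - d j) := by
    calc p (d j) = ‖f j (x - d j)‖ := by rw [map_sub, h0, zero_sub, norm_neg, hfd]
      _ ≤ _ := hf j _
  have h2 : p x ≤ p (x - d j) + p (d j) := by
    simpa using map_add_le_add p (x - d j) (d j)
  have h3 : p (x - d j) < p x / 4 := hz
  linarith

/-- A linear perturbation of the identity that is small for a continuous norm and bounded by it
is injective and maps closed sets to closed sets. -/
theorem isClosed_image_id_add [CompleteSpace X] {q : ℕ → Seminorm 𝕜 X}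
    (hq : WithSeminorms q) {p : Seminorm 𝕜 X} (hp : Continuous p)
    {K : X →ₗ[𝕜] X} (hKp : ∀ x, p (K x) ≤ p x / 2) {C : ℕ → ℝ}
    (hKq : ∀ s x, q s (K x) ≤ C s * p x) {A : Set X} (hA : IsClosed A) [T2Space X] :
    IsClosed ((LinearMap.id + K : X →ₗ[𝕜] X) '' A) := by
  set L : X →ₗ[𝕜] X := LinearMap.id + K with hL
  have hLx : ∀ x, L x = x + K x := fun x => rfl
  have hpL : ∀ x, p x ≤ 2 * p (L x) := by
    intro x
    have : p x ≤ p (L x) + p (K x) := by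
      simpa [hLx] using map_sub_le_add p (L x) (K x)
    linarith [hKp x]
  -- `L x` controls `x` in every seminorm, so `L` induces the topology and images of complete sets
  -- are complete.
  have hqL : ∀ s x, q s x ≤ q s (L x) + |C s| * (2 * p (L x)) := by
    intro s x
    have h1 : q s x ≤ q s (L x) + q s (K x) := by
      simpa [hLx] using map_sub_le_add (q s) (L x) (K x)
    have h2 : C s * p x ≤ |C s| * (2 * p (L x)) :=
      mul_le_mul (le_abs_self _) (hpL x) (apply_nonneg p x) (abs_nonneg _)
    linarith [hKq s x]
  have hKc : Tendsto K (𝓝 0) (𝓝 0) := by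
    refine (hq.tendsto_nhds _ _).2 fun s ε hε => ?_
    have : Tendsto (fun x => C s * p x) (𝓝 0) (𝓝 0) :=
      (hp.const_mul (C s)).tendsto' 0 0 (by simp)
    filter_upwards [this.eventually_lt_const hε] with x hx
    simpa using (hKq s x).trans_lt hx
  have hLc : Tendsto L (𝓝 0) (𝓝 0) := by
    have := (tendsto_id (x := 𝓝 (0 : X))).add hKc
    rwa [add_zero] at this
  have hind : Topology.IsInducing L := by
    have hLcont : Continuous L := continuous_of_continuousAt_zero L (by
      simpa [ContinuousAt] using hLc)
    refine (IsTopologicalAddGroup.isInducing_iff_nhds_zero (f := L)).2 (le_antisymm ?_ ?_)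
    · exact hLc.le_comap
    · change Tendsto id (comap L (𝓝 0)) (𝓝 0)
      refine (hq.tendsto_nhds _ _).2 fun s ε hε => ?_
      have h1 : Tendsto (fun z => q s z + |C s| * (2 * p z)) (𝓝 0) (𝓝 0) := by
        have hqs := hq.continuous_seminorm s
        exact (hqs.add (continuous_const.mul (continuous_const.mul hp))).tendsto' 0 0 (by simp)
      filter_upwards [(h1.comp tendsto_comap).eventually_lt_const hε] with x hx
      simpa using (hqL s x).trans_lt hx
  have hui : IsUniformInducing L := AddMonoidHom.isUniformInducing_of_isInducing hind
  exact ((isComplete_image_iff hui).2 hA.isComplete).isClosed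

end

/-! ### Construction of the hypercyclic subspace. -/

theorem theorem1p8 {𝕜 X Y : Type*} [RCLike 𝕜]
    [AddCommGroup X] [Module 𝕜 X] [UniformSpace X] [IsUniformAddGroup X]
    [AddCommGroup Y] [Module 𝕜 Y] [UniformSpace Y] [IsUniformAddGroup Y]
    (hX : IsFrechetSpace 𝕜 X) (hXdim : ¬ FiniteDimensional 𝕜 X) (hXnorm : HasContinuousNorm 𝕜 X)
    (hY : IsFrechetSpace 𝕜 Y) (hYsep : TopologicalSpace.SeparableSpace Y)
    (T : ℕ+ → X →L[𝕜] Y) (n : ℕ → ℕ+) (hC : SatisfiesConditionC T n)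
    (M₀ : Submodule 𝕜 X) (hM₀closed : IsClosed (M₀ : Set X)) (hM₀dim : ¬ FiniteDimensional 𝕜 M₀)
    (hM₀ : ∀ x ∈ M₀, Tendsto (fun k => T (n k) x) atTop (𝓝 0)) :
    ∃ M : Submodule 𝕜 X, IsHypercyclicSubspace T M := by
  obtain ⟨q, hq⟩ := hX.exists_seminorms
  obtain ⟨r, hr⟩ := hY.exists_seminorms
  obtain ⟨p, hp, hp0⟩ := hXnorm
  obtain ⟨X₀, hX₀, hS₀⟩ := hC.exists_dense
  have := hX.t2
  have := hX.complete
  have := hY.t2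
  have := hq.continuousSMul
  have := hr.continuousSMul
  -- `m` codes `((j, l), t)`; the free `t` makes every pair `(j, l)` recur infinitely often.
  let j : ℕ → ℕ := fun m => (Nat.unpair (Nat.unpair m).1).1
  let D : ℕ → Y := TopologicalSpace.denseSeq Y
  let y : ℕ → Y := fun m => D (Nat.unpair (Nat.unpair m).1).2
  obtain ⟨u, k, hk, hup, huq, huT⟩ := exists_almost_biorthogonal_seq hq hr hp (fun k => T (n k))
    hC.dense_iUnion hX₀ hS₀ y
  obtain ⟨M₁, hM₁, hM₁cl, hM₁dim, hM₁sep⟩ := exists_separable_closed_submodule hM₀closed hM₀dim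
  obtain ⟨f, hfp, hf⟩ := exists_separating_functionals hp hp0 hM₁sep
  -- The total 1/3 is below the 1/2 needed for `hKp`.
  have hgeom : HasSum (fun i : ℕ => (1 / 4 : ℝ) ^ (i + 1)) (1 / 3) := by
    have := (hasSum_geometric_of_lt_one (r := (1 / 4 : ℝ)) (by norm_num) (by norm_num)).mul_left
      (1 / 4)
    rw [show (1 / 4 : ℝ) * (1 - 1 / 4)⁻¹ = 1 / 3 by norm_num] at this
    exact this.congr_fun fun i => pow_succ' _ _
  have huqs : ∀ s, Summable fun i => q s (u i) := fun s =>
    Summable.of_norm_bounded_eventually_nat hgeom.summable <| by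
      filter_upwards [eventually_ge_atTop s] with i hi
      rw [Real.norm_of_nonneg (apply_nonneg _ _)]
      exact huq i s hi
  have hterm : ∀ (Q : Seminorm 𝕜 X) (x : X) (i : ℕ),
      Q (f (j i) x • u i) ≤ Q (u i) * p x := by
    intro Q x i
    rw [map_smul_eq_mul, mul_comm]
    exact mul_le_mul_of_nonneg_left (hfp _ _) (apply_nonneg _ _)
  have hsum : ∀ x, Summable fun i => f (j i) x • u i := fun x =>
    hq.summable_of_summable_seminorm fun s =>
      Summable.of_nonneg_of_le (fun _ => apply_nonneg _ _) (hterm (q s) x)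
        ((huqs s).mul_right (p x))
  let K : X →ₗ[𝕜] X :=
    { toFun := fun x => ∑' i, f (j i) x • u i
      map_add' := fun x z => by
        simp only [map_add, add_smul]
        exact (hsum x).tsum_add (hsum z)
      map_smul' := fun c x => by
        simp only [map_smul, smul_eq_mul, mul_smul, RingHom.id_apply]
        exact (hsum x).tsum_const_smul c }
  have hK : ∀ x, HasSum (fun i => f (j i) x • u i) (K x) := fun x => (hsum x).hasSum
  have hKq : ∀ s x, q s (K x) ≤ (∑' i, q s (u i)) * p x := fun s x =>
    Seminorm.le_of_hasSum (hq.continuous_seminorm s) (hK x) ((huqs s).hasSum.mul_right (p x))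
      (hterm (q s) x)
  have hKp : ∀ x, p (K x) ≤ p x / 2 := by
    intro x
    have := Seminorm.le_of_hasSum hp (hK x) (hgeom.mul_right (p x)) fun i =>
      (hterm p x i).trans (mul_le_mul_of_nonneg_right (hup i) (apply_nonneg p x))
    linarith [apply_nonneg p x]
  set L : X →ₗ[𝕜] X := LinearMap.id + K with hL
  have hLinj : Function.Injective L := by
    refine (injective_iff_map_eq_zero L).2 fun x hx => hp0 x ?_
    have hx' : x = -K x := eq_neg_of_add_eq_zero_left hx
    have h1 : p x = p (K x) := by
      conv_lhs => rw [hx', map_neg_eq_map]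
    linarith [hKp x, apply_nonneg p x]
  refine ⟨M₁.map L, fun hfin => hM₁dim ?_, ?_, ?_⟩
  · exact Module.Finite.equiv (Submodule.equivMapOfInjective L hLinj M₁).symm
  · rw [Submodule.map_coe]
    exact isClosed_image_id_add hq hp hKp hKq hM₁cl
  rintro _ ⟨z, hz, rfl⟩ hLz
  obtain ⟨j₀, hj₀⟩ := hf z hz fun h => hLz (by rw [h, map_zero])
  have hlim₁ : Tendsto (fun m => T (n (k m)) z) atTop (𝓝 0) :=
    (hM₀ z (hM₁ hz)).comp (tendsto_atTop_mono hk tendsto_id)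
  -- The factor 2 is `∑ (1/2)^i`; the diagonal term is removed by subtracting `f (j m) z • y m`.
  have hest : ∀ m, ∀ s ≤ m,
      r s (T (n (k m)) (K z) - f (j m) z • y m) ≤ (1 / 2) ^ m * 2 * p z := by
    intro m s hs
    have h1 : HasSum (fun i => f (j i) z • (T (n (k m)) (u i) - if i = m then y m else 0))
        (T (n (k m)) (K z) - f (j m) z • y m) := by
      have h2 := ((hK z).mapL (T (n (k m)))).sub (hasSum_ite_eq m (f (j m) z • y m))
      refine h2.congr_fun fun i => ?_
      by_cases hi : i = m
      · subst hi; simp [smul_sub]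
      · simp [hi]
    refine Seminorm.le_of_hasSum (hr.continuous_seminorm s) h1
      ((hasSum_geometric_two.mul_left ((1 / 2) ^ m)).mul_right (p z)) fun i => ?_
    rw [map_smul_eq_mul, mul_comm]
    exact mul_le_mul (huT m s hs i) (hfp _ _) (norm_nonneg _) (by positivity)
  have hlim₂ : Tendsto (fun m => T (n (k m)) (K z) - f (j m) z • y m) atTop (𝓝 0) := by
    refine (hr.tendsto_nhds _ _).2 fun s ε hε => ?_
    have h1 : Tendsto (fun m : ℕ => (1 / 2 : ℝ) ^ m * 2 * p z) atTop (𝓝 0) := by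
      simpa using ((tendsto_pow_atTop_nhds_zero_of_lt_one (r := (1 / 2 : ℝ)) (by norm_num)
        (by norm_num)).mul_const 2).mul_const (p z)
    filter_upwards [h1.eventually_lt_const hε, eventually_ge_atTop s] with m hm hs
    simpa using (hest m s hs).trans_lt hm
  have hdense : Dense (Set.range fun l => f j₀ z • D l) :=
    (Homeomorph.smulOfNeZero (f j₀ z) hj₀).surjective.denseRange.comp
      (TopologicalSpace.denseRange_denseSeq Y) (Homeomorph.smulOfNeZero (f j₀ z) hj₀).continuous
  refine dense_closure.1 (hdense.mono ?_)
  rintro _ ⟨l, rfl⟩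
  let φ : ℕ → ℕ := fun t => Nat.pair (Nat.pair j₀ l) t
  have hφ : Tendsto φ atTop atTop := tendsto_atTop_mono (fun t => Nat.right_le_pair _ t) tendsto_id
  have hlim₃ : Tendsto (fun t => T (n (k (φ t))) (L z)) atTop (𝓝 (f j₀ z • D l)) := by
    have h1 := ((hlim₁.add hlim₂).comp hφ).add_const (f j₀ z • D l)
    rw [add_zero, zero_add] at h1
    refine h1.congr fun t => ?_
    simp only [j, y, φ, hL, Function.comp_apply, Nat.unpair_pair, LinearMap.add_apply,
      LinearMap.id_apply, map_add]
    abel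
  exact mem_closure_of_tendsto hlim₃ (Eventually.of_forall fun t => ⟨n (k (φ t)), rfl⟩)
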